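/- All Hilbert spaces are finite dimensional, and $\log$ is taken to any fixed base $b>1$. For a state $\rho$ let $S(\rho)=-\operatorname{tr}\rho\log\rho$. For a map $\Psi$ that takes density operators to density operators let $S_{\min}(\Psi)=\min_\rho S(\Psi(\rho))$, the minimum being over all density operators $\rho$ on the input space. Let $\Phi$ be a quantum channel (a completely positive trace preserving linear map) from operators on $\mathcal H\neq 0$ to operators on $\mathcal K$. Then $\Phi$ has a Stinespring dilation $$\Phi(X)=\operatorname{tr}_{\mathcal B}\,U\,(|0\rangle\langle 0|\otimes X)\,U^*,$$ with spaces $\mathcal A,\mathcal B$, a basis vector $|0\rangle$ of $\mathcal A$, and a unitary map $U:\mathcal A\otimes\mathcal H\to\mathcal K\otimes\mathcal B$. Given any such dilation, let $P_0=|0\rangle\langle 0|\otimes I_{\mathcal H}$ and $P_1=(I_{\mathcal A}-|0\rangle\langle 0|)\otimes I_{\mathcal H}$, and define for operators $X$ on $\mathcal A\otimes\mathcal H$ and $Y$ on $\mathcal K\otimes\mathcal B$ $$D(X)=\tfrac12 X+\tfrac12 (P_0-P_1)X(P_0-P_1),$$ $$M(X)=P_0XP_0+\operatorname{tr}(P_1XP_1)\,\frac{I_{\mathcal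 A}-|0\rangle\langle 0|}{\dim\mathcal A-1}\otimes\frac{I_{\mathcal H}}{\dim\mathcal H},$$ $$N_{\mathcal B}(Y)=(\operatorname{tr}_{\mathcal B}Y)\otimes\frac{I_{\mathcal B}}{\dim\mathcal B},\qquad \Phi'(X)=N_{\mathcal B}\bigl(U\,M(D(X))\,U^*\bigr)$$ (if $\dim\mathcal A=1$, the second term of $M$ is read as $0$). Then $\Phi'$ is random unitary, i.e. $\Phi'(X)=\sum_i p_iU_iXU_i^*$ for finitely many unitary maps $U_i:\mathcal A\otimes\mathcal H\to\mathcal K\otimes\mathcal B$ and a probability distribution $(p_i)$, and $$S_{\min}(\Phi)\;\ge\; S_{\min}(\Phi')-\log\dim\mathcal B\;\ge\; S_{\min}(\Phi)-\frac{8\log\dim\mathcal A}{\dim\mathcal A}.$$ -/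

import Mathlib

open scoped Kronecker ComplexOrder

namespace QChan

/-- Density operators on the Hilbert space `ℂ^H`: positive semidefinite, of unit trace. -/
def IsDensity {H : Type*} [Fintype H] (ρ : Matrix H H ℂ) : Prop :=
  ρ.PosSemidef ∧ ρ.trace = 1

/-- The map `id_n ⊗ Φ` on operators of `ℂ^n ⊗ ℂ^H`. -/
def ampliation {H K : Type*} (n : ℕ) (Φ : Matrix H H ℂ →ₗ[ℂ] Matrix K K ℂ)
    (X : Matrix (Fin n × H) (Fin n × H) ℂ) : Matrix (Fin n × K) (Fin n × K) ℂ :=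
  Matrix.of fun p q => Φ (Matrix.of fun x y => X (p.1, x) (q.1, y)) p.2 q.2

/-- Quantum channels: completely positive, trace preserving linear maps. -/
structure IsChannel {H K : Type*} [Fintype H] [Fintype K]
    (Φ : Matrix H H ℂ →ₗ[ℂ] Matrix K K ℂ) : Prop where
  completelyPositive : ∀ (n : ℕ) (X : Matrix (Fin n × H) (Fin n × H) ℂ),
    X.PosSemidef → (ampliation n Φ X).PosSemidef
  tracePreserving : ∀ X : Matrix H H ℂ, (Φ X).trace = X.trace

/-- `U` is a unitary map from `ℂ^I` onto `ℂ^J`. -/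
def IsUnitaryMap {I J : Type*} [Fintype I] [Fintype J] [DecidableEq I] [DecidableEq J]
    (U : Matrix J I ℂ) : Prop :=
  U.conjTranspose * U = 1 ∧ U * U.conjTranspose = 1

/-- A map is random unitary if it is a finite convex combination of unitary conjugations. -/
def IsRandomUnitary {I J : Type*} [Fintype I] [Fintype J] [DecidableEq I] [DecidableEq J]
    (Ψ : Matrix I I ℂ → Matrix J J ℂ) : Prop :=
  ∃ (n : ℕ) (p : Fin n → ℝ) (U : Fin n → Matrix J I ℂ),
    (∀ i, 0 ≤ p i) ∧ ∑ i, p i = 1 ∧ (∀ i, IsUnitaryMap (U i)) ∧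
      ∀ X, Ψ X = ∑ i, (p i : ℂ) • (U i * X * (U i).conjTranspose)

/-- The von Neumann entropy `S(ρ) = - tr ρ log ρ`, with logarithms to base `b`. The operator
`log ρ` is given by the functional calculus; as `logb b 0 = 0`, this respects `0 log 0 = 0`. -/
noncomputable def entropy (b : ℝ) {H : Type*} [Fintype H] [DecidableEq H]
    (ρ : Matrix H H ℂ) : ℝ :=
  -(ρ * cfc (Real.logb b) ρ).trace.re

/-- The minimum output entropy: the infimum of `S(Φ(ρ))` over all density operators `ρ`. -/
noncomputable def minOutputEntropy (b : ℝ) {H K : Type*} [Fintype H] [Fintype K]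
    [DecidableEq K] (Φ : Matrix H H ℂ → Matrix K K ℂ) : ℝ :=
  sInf {s | ∃ ρ : Matrix H H ℂ, IsDensity ρ ∧ s = entropy b (Φ ρ)}

/-- The partial trace over the second tensor factor. -/
def partialTrace {K B : Type*} [Fintype B] (X : Matrix (K × B) (K × B) ℂ) : Matrix K K ℂ :=
  Matrix.of fun i j => ∑ b, X (i, b) (j, b)

/-- The maximally mixed state `I / dim`. -/
noncomputable def maxMixed (H : Type*) [Fintype H] [DecidableEq H] : Matrix H H ℂ :=
  (Fintype.card H : ℂ)⁻¹ • (1 : Matrix H H ℂ)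

/-- The projector `|0⟩⟨0|` onto the basis vector of `ℂ^A` with label `a₀`. -/
def ketbra {A : Type*} [DecidableEq A] (a₀ : A) : Matrix A A ℂ :=
  Matrix.single a₀ a₀ 1

section Construction

variable {A B H K : Type*} [Fintype A] [Fintype B] [Fintype H] [Fintype K]
  [DecidableEq A] [DecidableEq B] [DecidableEq H] [DecidableEq K]

/-- `Φ(X) = tr_B U (|0⟩⟨0| ⊗ X) U*` with `U : A ⊗ H → K ⊗ B` unitary. -/
def IsStinespringDilation (Φ : Matrix H H ℂ → Matrix K K ℂ) (a₀ : A)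
    (U : Matrix (K × B) (A × H) ℂ) : Prop :=
  IsUnitaryMap U ∧ ∀ X, Φ X = partialTrace (U * (ketbra a₀ ⊗ₖ X) * U.conjTranspose)

/-- The projector onto the subspace `S₀ = |0⟩ ⊗ H`. -/
def projZero (a₀ : A) : Matrix (A × H) (A × H) ℂ :=
  ketbra a₀ ⊗ₖ (1 : Matrix H H ℂ)

/-- The projector onto the orthogonal complement of `S₀`. -/
def projPerp (a₀ : A) : Matrix (A × H) (A × H) ℂ :=
  (1 - ketbra a₀) ⊗ₖ (1 : Matrix H H ℂ)

/-- The unitary that is `1` on `S₀` and `-1` on its orthogonal complement. -/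
def phaseFlip (a₀ : A) : Matrix (A × H) (A × H) ℂ :=
  projZero a₀ - projPerp a₀

/-- The decohering operation `D`: the phase flip is applied with probability one half. -/
noncomputable def decohere (a₀ : A) (X : Matrix (A × H) (A × H) ℂ) :
    Matrix (A × H) (A × H) ℂ :=
  (1 / 2 : ℂ) • X + (1 / 2 : ℂ) • (phaseFlip a₀ * X * (phaseFlip a₀).conjTranspose)

/-- The mixing operation `M`: it leaves operators on `S₀` unchanged and replaces operators on the
orthogonal complement by a multiple of the maximally mixed state
`(I_A - |0⟩⟨0|) / (dim A - 1) ⊗ I_H / dim H` there. It is only ever applied after `decohere`, that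
is, to operators that are block diagonal with respect to `S₀` and its complement. (If `dim A = 1`
the complement is zero, and so is the second term.) -/
noncomputable def mix (a₀ : A) (X : Matrix (A × H) (A × H) ℂ) : Matrix (A × H) (A × H) ℂ :=
  projZero a₀ * X * projZero a₀ +
    (projPerp a₀ * X * projPerp a₀).trace •
      ((((Fintype.card A : ℂ) - 1)⁻¹ • (1 - ketbra a₀)) ⊗ₖ maxMixed H)

/-- The operation `N_B`, which takes the system `B` to its maximally mixed state. -/
noncomputable def mixOut (X : Matrix (K × B) (K × B) ℂ) : Matrix (K × B) (K × B) ℂ :=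
  partialTrace X ⊗ₖ maxMixed B

/-- The random unitary approximation `Φ'(X) = N_B (U [(M ∘ D)(X)] U*)` that is constructed from a
dilation `U`. -/
noncomputable def ruApprox (a₀ : A) (U : Matrix (K × B) (A × H) ℂ)
    (X : Matrix (A × H) (A × H) ℂ) : Matrix (K × B) (K × B) ℂ :=
  mixOut (U * mix a₀ (decohere a₀ X) * U.conjTranspose)

end Construction

end QChan

set_option linter.unusedSectionVars false

/-! Let `p` be the weight of the input on `|0⟩ ⊗ H` and `ρ` its normalized block there. Then `Φ'`
outputs `(p Φ(ρ) + (1 - p) ω) ⊗ I_B / dim B`, where `ω` (`perpOutput`) is a fixed state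
(`ruApprox_eq`). The factor `I_B / dim B` adds exactly `log dim B` to the entropy, so inputs `|0⟩⟨0|
⊗ ρ` reproduce the outputs of `Φ` and give the upper bound.

For the lower bound, `tr_B (U U*) = dim B · I` yields `ω = (dim A - 1)⁻¹ ((dim B / dim H) I - Φ(I /
dim H))`. As `dim K · dim B = dim A · dim H`, the eigenvalues of `ω` are at most `(dim A / (dim A -
1)) / dim K`, so `S(ω) ≥ log dim K - log (dim A / (dim A - 1))`. Since `S_min(Φ) ≤ log dim K`,
concavity of the entropy costs at most the last logarithm, which `logb_div_sub_one_le` bounds.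

`Φ'` is random unitary because `M` and `N_B` are averages over signed permutations: signs kill
off-diagonal entries, permutations equalize the diagonal. -/

namespace QChan

open Matrix

/-! ### Spectral formulas for the von Neumann entropy, and its concavity. -/

section Entropy

variable {n m : Type*} [Fintype n] [DecidableEq n] [Fintype m] [DecidableEq m]

theorem neg_mul_logb_eq (b x : ℝ) : -(x * Real.logb b x) = Real.negMulLog x / Real.log b := by
  rw [Real.logb, Real.negMulLog]; ring

theorem spectral_decomposition {A : Matrix n n ℂ} (hA : A.IsHermitian) :
    ∃ V : Matrix n n ℂ, Vᴴ * V = 1 ∧ V * Vᴴ = 1 ∧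
      A = V * diagonal (fun i => (hA.eigenvalues i : ℂ)) * Vᴴ := by
  refine ⟨hA.eigenvectorUnitary, ?_, ?_, ?_⟩
  · exact Unitary.coe_star_mul_self _
  · exact Unitary.coe_mul_star_self _
  · conv_lhs => rw [hA.spectral_theorem, Unitary.conjStarAlgAut_apply]
    rfl

theorem entropy_eq_sum_eigenvalues (b : ℝ) {A : Matrix n n ℂ} (hA : A.IsHermitian) :
    entropy b A = ∑ i, -(hA.eigenvalues i * Real.logb b (hA.eigenvalues i)) := by
  have hU : star (hA.eigenvectorUnitary : Matrix n n ℂ) *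
      (hA.eigenvectorUnitary : Matrix n n ℂ) = 1 :=
    Unitary.coe_star_mul_self _
  have h : A * cfc (Real.logb b) A = (hA.eigenvectorUnitary : Matrix n n ℂ) *
      diagonal (fun i => ((hA.eigenvalues i * Real.logb b (hA.eigenvalues i) : ℝ) : ℂ)) *
      star (hA.eigenvectorUnitary : Matrix n n ℂ) := by
    rw [hA.cfc_eq, Matrix.IsHermitian.cfc, Unitary.conjStarAlgAut_apply]
    nth_rw 1 [hA.spectral_theorem]
    rw [Unitary.conjStarAlgAut_apply]
    have : ∀ U D E V : Matrix n n ℂ, V * U = 1 → U * D * V * (U * E * V) = U * (D * E) * V := by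
      intro U D E V h
      calc U * D * V * (U * E * V) = U * D * (V * U) * E * V := by simp only [Matrix.mul_assoc]
        _ = _ := by rw [h]; simp only [Matrix.mul_assoc, Matrix.mul_one]
    refine (this _ _ _ _ hU).trans ?_
    rw [diagonal_mul_diagonal]
    simp [Function.comp_def]
  rw [entropy, h, Matrix.trace_mul_comm, ← Matrix.mul_assoc, hU, Matrix.one_mul, trace_diagonal,
    Complex.re_sum, ← Finset.sum_neg_distrib]
  simp

/-- Both families list the roots of the characteristic polynomial with multiplicity, so entropies
may be computed from any unitary diagonalization. -/
theorem sum_eigenvalues_of_diagonalization {V : Matrix n n ℂ} (hV : Vᴴ * V = 1) (a : n → ℝ)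
    {A : Matrix n n ℂ} (hA : A.IsHermitian) (h : A = V * diagonal (fun i => (a i : ℂ)) * Vᴴ)
    (f : ℝ → ℝ) : ∑ i, f (hA.eigenvalues i) = ∑ i, f (a i) := by
  have h1 := hA.roots_charpoly_eq_eigenvalues
  have h2 : A.charpoly.roots = Multiset.map (fun i => (a i : ℂ)) Finset.univ.val := by
    rw [h, charpoly_mul_comm, ← Matrix.mul_assoc, hV, Matrix.one_mul, charpoly_diagonal,
      Polynomial.roots_prod]
    · simp
    · simp [Finset.prod_ne_zero_iff, Polynomial.X_sub_C_ne_zero]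
  rw [h2] at h1
  have h3 := congrArg (fun s => (Multiset.map (fun z : ℂ => f z.re) s).sum) h1
  simpa [Multiset.map_map, Function.comp_def] using h3.symm

omit [Fintype n] [DecidableEq n] in
theorem isHermitian_conj_diagonal (V : Matrix n m ℂ) (a : m → ℝ) :
    (V * diagonal (fun i => (a i : ℂ)) * Vᴴ).IsHermitian := by
  apply isHermitian_mul_mul_conjTranspose
  rw [Matrix.IsHermitian, diagonal_conjTranspose]
  congr 1; ext i; simp

theorem entropy_conj_diagonal (b : ℝ) {V : Matrix n n ℂ} (hV : Vᴴ * V = 1) (a : n → ℝ) :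
    entropy b (V * diagonal (fun i => (a i : ℂ)) * Vᴴ) = ∑ i, -(a i * Real.logb b (a i)) := by
  rw [entropy_eq_sum_eigenvalues b (isHermitian_conj_diagonal V a)]
  exact sum_eigenvalues_of_diagonalization hV a _ rfl (fun x => -(x * Real.logb b x))

namespace IsDensity

variable {ρ : Matrix n n ℂ}

theorem sum_eigenvalues (hρ : IsDensity ρ) : ∑ i, hρ.1.isHermitian.eigenvalues i = 1 := by
  have h := hρ.1.isHermitian.trace_eq_sum_eigenvalues
  have h' := congrArg Complex.re (hρ.2.symm.trans h)
  simpa using h'.symm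

theorem eigenvalues_le_one (hρ : IsDensity ρ) (i : n) : hρ.1.isHermitian.eigenvalues i ≤ 1 := by
  rw [← hρ.sum_eigenvalues]
  exact Finset.single_le_sum (fun j _ => hρ.1.eigenvalues_nonneg j) (Finset.mem_univ i)

omit [DecidableEq n] in
theorem nonempty (hρ : IsDensity ρ) : Nonempty n := by
  by_contra h
  rw [not_nonempty_iff] at h
  have := hρ.2
  simp [Matrix.trace] at this

theorem entropy_nonneg {b : ℝ} (hb : 1 < b) (hρ : IsDensity ρ) : 0 ≤ entropy b ρ := by
  rw [entropy_eq_sum_eigenvalues b hρ.1.isHermitian]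
  refine Finset.sum_nonneg fun i _ => ?_
  rw [neg_mul_logb_eq]
  exact div_nonneg (Real.negMulLog_nonneg (hρ.1.eigenvalues_nonneg i) (hρ.eigenvalues_le_one i))
    (Real.log_pos hb).le

/-- The von Neumann entropy is at least the min-entropy. -/
theorem neg_logb_le_entropy {b c : ℝ} (hb : 1 < b) (hρ : IsDensity ρ)
    (hc : ∀ i, hρ.1.isHermitian.eigenvalues i ≤ c) : -Real.logb b c ≤ entropy b ρ := by
  rw [entropy_eq_sum_eigenvalues b hρ.1.isHermitian]
  calc -Real.logb b c = ∑ i, hρ.1.isHermitian.eigenvalues i * -Real.logb b c := by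
        rw [← Finset.sum_mul, hρ.sum_eigenvalues, one_mul]
    _ ≤ _ := Finset.sum_le_sum fun i _ => ?_
  rw [← mul_neg]
  rcases (hρ.1.eigenvalues_nonneg i).eq_or_lt with h | h
  · simp [← h]
  · exact mul_le_mul_of_nonneg_left (neg_le_neg (Real.logb_le_logb_of_le hb h (hc i))) h.le

theorem entropy_le_logb_card {b : ℝ} (hb : 1 < b) (hρ : IsDensity ρ) :
    entropy b ρ ≤ Real.logb b (Fintype.card n) := by
  have := hρ.nonempty
  have hd : (0 : ℝ) < Fintype.card n := by exact_mod_cast Fintype.card_pos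
  -- Jensen's inequality with uniform weights on the eigenvalues.
  have h := Real.concaveOn_negMulLog.le_map_sum (t := Finset.univ)
    (w := fun _ : n => (Fintype.card n : ℝ)⁻¹) (p := hρ.1.isHermitian.eigenvalues)
    (fun _ _ => by positivity) (by simp [hd.ne']) (fun i _ => hρ.1.eigenvalues_nonneg i)
  simp only [smul_eq_mul, ← Finset.mul_sum, hρ.sum_eigenvalues, mul_one] at h
  rw [entropy_eq_sum_eigenvalues b hρ.1.isHermitian]
  simp only [neg_mul_logb_eq, ← Finset.sum_div]
  rw [Real.logb]
  refine div_le_div_of_nonneg_right ?_ (Real.log_pos hb).le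
  rw [Real.negMulLog, Real.log_inv, neg_mul_neg] at h
  exact le_of_mul_le_mul_left h (by positivity)

end IsDensity

theorem conj_diagonal_kronecker_maxMixed (V : Matrix n n ℂ) (a : n → ℝ) :
    (V * diagonal (fun i => (a i : ℂ)) * Vᴴ) ⊗ₖ maxMixed m =
      (V ⊗ₖ (1 : Matrix m m ℂ)) *
        diagonal (fun i : n × m => ((a i.1 / Fintype.card m : ℝ) : ℂ)) *
        (V ⊗ₖ (1 : Matrix m m ℂ))ᴴ := by
  have h : diagonal (fun i : n × m => ((a i.1 / Fintype.card m : ℝ) : ℂ)) =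
      diagonal (fun i => (a i : ℂ)) ⊗ₖ maxMixed m := by
    rw [maxMixed, ← diagonal_one, ← diagonal_smul, diagonal_kronecker_diagonal]
    congr 1; ext i; simp [div_eq_mul_inv]
  rw [h, conjTranspose_kronecker, ← mul_kronecker_mul, ← mul_kronecker_mul]
  simp

/-- Each eigenvalue `x` of `ρ` turns into `card m` eigenvalues `x / card m`. -/
theorem entropy_kronecker_maxMixed [Nonempty m] (b : ℝ) {ρ : Matrix n n ℂ} (hρ : IsDensity ρ) :
    entropy b (ρ ⊗ₖ maxMixed m) = entropy b ρ + Real.logb b (Fintype.card m) := by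
  have hH := hρ.1.isHermitian
  obtain ⟨V, h1, h2, h3⟩ := spectral_decomposition hH
  have hd : (Fintype.card m : ℝ) ≠ 0 := by simp
  have h4 : entropy b (ρ ⊗ₖ maxMixed m) = ∑ i : n × m,
      -(hH.eigenvalues i.1 / Fintype.card m *
        Real.logb b (hH.eigenvalues i.1 / Fintype.card m)) := by
    conv_lhs => rw [h3, conj_diagonal_kronecker_maxMixed V]
    refine entropy_conj_diagonal b ?_ _
    rw [conjTranspose_kronecker, ← mul_kronecker_mul, h1]
    simp
  rw [h4, entropy_eq_sum_eigenvalues b hH, Fintype.sum_prod_type]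
  have h5 : ∀ x : ℝ, -(x / Fintype.card m * Real.logb b (x / Fintype.card m)) =
      (Fintype.card m : ℝ)⁻¹ * (-(x * Real.logb b x) + x * Real.logb b (Fintype.card m)) := by
    intro x
    rcases eq_or_ne x 0 with rfl | hx
    · simp
    · rw [Real.logb_div hx hd]; ring
  simp only [h5, Finset.sum_const, Finset.card_univ, nsmul_eq_mul]
  simp only [mul_inv_cancel_left₀ hd, Finset.sum_add_distrib, ← Finset.sum_mul,
    hρ.sum_eigenvalues, one_mul]

/-- Peierls' inequality: the diagonal of a positive matrix in any orthonormal basis is at least as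
mixed as its spectrum. -/
theorem entropy_le_sum_diag {b : ℝ} (hb : 1 < b) {A W : Matrix n n ℂ} (hA : A.PosSemidef)
    (hW : Wᴴ * W = 1) :
    entropy b A ≤ ∑ i, Real.negMulLog ((Wᴴ * A * W) i i).re / Real.log b := by
  obtain ⟨V, h1, h2, h3⟩ := spectral_decomposition hA.isHermitian
  set a := hA.isHermitian.eigenvalues with ha
  set T : Matrix n n ℂ := Wᴴ * V with hT
  have hT1 : T * Tᴴ = 1 := by
    rw [hT, conjTranspose_mul, conjTranspose_conjTranspose, Matrix.mul_assoc,
      ← Matrix.mul_assoc V, h2, Matrix.one_mul, hW]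
  have hT2 : Tᴴ * T = 1 := mul_eq_one_comm.mp hT1
  -- The numbers `|T i j|²` form a doubly stochastic matrix taking the spectrum to the diagonal;
  -- rows summing to one permit Jensen, columns summing to one recover the entropy.
  have hrow : ∀ i, ∑ j, Complex.normSq (T i j) = 1 := by
    intro i
    have := congrArg Complex.re (congrFun (congrFun hT1 i) i)
    simpa [Matrix.mul_apply, Complex.mul_conj] using this
  have hcol : ∀ j, ∑ i, Complex.normSq (T i j) = 1 := by
    intro j
    have := congrArg Complex.re (congrFun (congrFun hT2 j) j)
    simpa [Matrix.mul_apply, ← Complex.normSq_eq_conj_mul_self] using this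
  have hdiag : ∀ i, ((Wᴴ * A * W) i i).re = ∑ j, Complex.normSq (T i j) * a j := by
    intro i
    have : Wᴴ * A * W = T * diagonal (fun i => (a i : ℂ)) * Tᴴ := by
      conv_lhs => rw [h3]
      simp only [hT, conjTranspose_mul, conjTranspose_conjTranspose, Matrix.mul_assoc]
    rw [this, Matrix.mul_apply, Complex.re_sum]
    refine Finset.sum_congr rfl fun j _ => ?_
    rw [mul_diagonal, conjTranspose_apply, mul_right_comm, RCLike.star_def, Complex.mul_conj,
      ← Complex.ofReal_mul, Complex.ofReal_re]
  have hJ : ∀ i, ∑ j, Complex.normSq (T i j) * Real.negMulLog (a j) ≤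
      Real.negMulLog ((Wᴴ * A * W) i i).re := by
    intro i
    rw [hdiag]
    exact Real.concaveOn_negMulLog.le_map_sum (t := Finset.univ)
      (fun _ _ => Complex.normSq_nonneg _) (hrow i) (fun j _ => hA.eigenvalues_nonneg j)
  rw [entropy_eq_sum_eigenvalues b hA.isHermitian]
  simp only [neg_mul_logb_eq, ← Finset.sum_div]
  refine div_le_div_of_nonneg_right ?_ (Real.log_pos hb).le
  refine le_trans (le_of_eq ?_) (Finset.sum_le_sum fun i _ => hJ i)
  rw [Finset.sum_comm]
  simp [← Finset.sum_mul, hcol, ← ha]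

/-- Concavity of the von Neumann entropy. -/
theorem entropy_concave {b : ℝ} (hb : 1 < b) {A B : Matrix n n ℂ} (hA : A.PosSemidef)
    (hB : B.PosSemidef) {p q : ℝ} (hp : 0 ≤ p) (hq : 0 ≤ q) (hpq : p + q = 1) :
    p * entropy b A + q * entropy b B ≤ entropy b ((p : ℂ) • A + (q : ℂ) • B) := by
  have hC : ((p : ℂ) • A + (q : ℂ) • B).PosSemidef :=
    (hA.smul (by exact_mod_cast hp)).add (hB.smul (by exact_mod_cast hq))
  -- In an eigenbasis of the mixture its eigenvalues are the mixed diagonals of `A` and `B`. Peierls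
  -- bounds each entropy by its diagonal, and scalar concavity of `negMulLog` does the rest.
  obtain ⟨W, h1, h2, h3⟩ := spectral_decomposition hC.isHermitian
  set c := hC.isHermitian.eigenvalues with hc
  have hd : Wᴴ * ((p : ℂ) • A + (q : ℂ) • B) * W = diagonal (fun i => (c i : ℂ)) := by
    calc _ = Wᴴ * W * diagonal (fun i => (c i : ℂ)) * (Wᴴ * W) := by
          conv_lhs => rw [h3]
          simp only [Matrix.mul_assoc]
      _ = _ := by simp [h1]
  have hci : ∀ i, c i = p * ((Wᴴ * A * W) i i).re + q * ((Wᴴ * B * W) i i).re := by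
    intro i
    have := congrArg Complex.re (congrFun (congrFun hd i) i)
    simpa [Matrix.mul_add, Matrix.add_mul] using this.symm
  have hAi : ∀ i, 0 ≤ ((Wᴴ * A * W) i i).re := fun i =>
    (Complex.nonneg_iff.mp ((hA.conjTranspose_mul_mul_same W).diag_nonneg (i := i))).1
  have hBi : ∀ i, 0 ≤ ((Wᴴ * B * W) i i).re := fun i =>
    (Complex.nonneg_iff.mp ((hB.conjTranspose_mul_mul_same W).diag_nonneg (i := i))).1
  rw [entropy_eq_sum_eigenvalues b hC.isHermitian]
  calc p * entropy b A + q * entropy b B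
      ≤ p * ∑ i, Real.negMulLog ((Wᴴ * A * W) i i).re / Real.log b +
        q * ∑ i, Real.negMulLog ((Wᴴ * B * W) i i).re / Real.log b :=
        add_le_add (mul_le_mul_of_nonneg_left (entropy_le_sum_diag hb hA h1) hp)
          (mul_le_mul_of_nonneg_left (entropy_le_sum_diag hb hB h1) hq)
    _ ≤ _ := by
        rw [Finset.mul_sum, Finset.mul_sum, ← Finset.sum_add_distrib]
        refine Finset.sum_le_sum fun i _ => ?_
        rw [neg_mul_logb_eq, ← mul_div_assoc, ← mul_div_assoc, ← add_div]
        refine div_le_div_of_nonneg_right ?_ (Real.log_pos hb).le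
        rw [← hc, hci]
        exact Real.concaveOn_negMulLog.2 (hAi i) (hBi i) hp hq hpq

end Entropy

/-! ### Random unitary maps and twirling by signed permutations. -/

section RandomUnitary

variable {I J L : Type*} [Fintype I] [Fintype J] [Fintype L] [DecidableEq I] [DecidableEq J]
  [DecidableEq L]

theorem isRandomUnitary_of_fintype {ι : Type*} [Fintype ι] {Ψ : Matrix I I ℂ → Matrix J J ℂ}
    (p : ι → ℝ) (U : ι → Matrix J I ℂ) (hp : ∀ i, 0 ≤ p i) (hp1 : ∑ i, p i = 1)
    (hU : ∀ i, IsUnitaryMap (U i)) (h : ∀ X, Ψ X = ∑ i, (p i : ℂ) • (U i * X * (U i)ᴴ)) :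
    IsRandomUnitary Ψ := by
  let e := (Fintype.equivFin ι).symm
  refine ⟨Fintype.card ι, p ∘ e, U ∘ e, fun i => hp _, ?_, fun i => hU _, fun X => ?_⟩
  · rw [← hp1]; exact e.sum_comp p
  · rw [h]; exact (e.sum_comp fun i => (p i : ℂ) • (U i * X * (U i)ᴴ)).symm

theorem isRandomUnitary_average {ι : Type*} [Fintype ι] [Nonempty ι]
    {Ψ : Matrix I I ℂ → Matrix J J ℂ} (U : ι → Matrix J I ℂ) (hU : ∀ i, IsUnitaryMap (U i))
    (h : ∀ X, Ψ X = (Fintype.card ι : ℂ)⁻¹ • ∑ i, U i * X * (U i)ᴴ) :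
    IsRandomUnitary Ψ := by
  refine isRandomUnitary_of_fintype (fun _ => (Fintype.card ι : ℝ)⁻¹) U (fun _ => by positivity)
    (by simp) hU fun X => ?_
  rw [h, Finset.smul_sum]
  simp

theorem isRandomUnitary_conj {U : Matrix J I ℂ} (hU : IsUnitaryMap U) :
    IsRandomUnitary fun X : Matrix I I ℂ => U * X * Uᴴ :=
  isRandomUnitary_average (ι := Unit) (fun _ => U) (fun _ => hU) fun X => by simp

theorem IsUnitaryMap.mul {U : Matrix J I ℂ} {V : Matrix L J ℂ} (hV : IsUnitaryMap V)
    (hU : IsUnitaryMap U) : IsUnitaryMap (V * U) := by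
  constructor
  · rw [conjTranspose_mul, Matrix.mul_assoc, ← Matrix.mul_assoc Vᴴ, hV.1, Matrix.one_mul, hU.1]
  · rw [conjTranspose_mul, Matrix.mul_assoc, ← Matrix.mul_assoc U, hU.2, Matrix.one_mul, hV.2]

theorem IsRandomUnitary.comp {Ψ : Matrix I I ℂ → Matrix J J ℂ} {Θ : Matrix J J ℂ → Matrix L L ℂ}
    (hΘ : IsRandomUnitary Θ) (hΨ : IsRandomUnitary Ψ) : IsRandomUnitary (Θ ∘ Ψ) := by
  obtain ⟨k, p, U, hp, hp1, hU, h⟩ := hΨ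
  obtain ⟨l, q, V, hq, hq1, hV, h'⟩ := hΘ
  refine isRandomUnitary_of_fintype (ι := Fin l × Fin k) (fun i => q i.1 * p i.2)
    (fun i => V i.1 * U i.2) (fun i => mul_nonneg (hq _) (hp _)) ?_
    (fun i => (hV _).mul (hU _)) fun X => ?_
  · simp [Fintype.sum_prod_type, ← Finset.mul_sum, hp1, hq1]
  · rw [Function.comp_apply, h', Fintype.sum_prod_type]
    refine Finset.sum_congr rfl fun i _ => ?_
    rw [h, Matrix.mul_sum, Matrix.sum_mul, Finset.smul_sum]
    refine Finset.sum_congr rfl fun j _ => ?_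
    simp only [Matrix.mul_smul, Matrix.smul_mul, smul_smul, conjTranspose_mul, Matrix.mul_assoc,
      Complex.ofReal_mul]

/-- The signed permutation matrix with signs `s` and permutation `σ`. -/
def signedPerm (s : I → ℤˣ) (σ : Equiv.Perm I) : Matrix I I ℂ :=
  Matrix.of fun i j => if σ i = j then ((s i : ℤ) : ℂ) else 0

theorem signedPerm_conj_apply (s : I → ℤˣ) (σ : Equiv.Perm I) (X : Matrix I I ℂ) (i j : I) :
    (signedPerm s σ * X * (signedPerm s σ)ᴴ) i j =
      ((s i : ℤ) : ℂ) * ((s j : ℤ) : ℂ) * X (σ i) (σ j) := by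
  simp [Matrix.mul_apply, signedPerm, ite_mul, apply_ite]
  ring

theorem isUnitaryMap_signedPerm (s : I → ℤˣ) (σ : Equiv.Perm I) :
    IsUnitaryMap (signedPerm s σ) := by
  have h : signedPerm s σ * (signedPerm s σ)ᴴ = 1 := by
    ext i j
    have := signedPerm_conj_apply s σ 1 i j
    rw [Matrix.mul_one] at this
    rw [this, Matrix.one_apply, Matrix.one_apply]
    rcases eq_or_ne i j with rfl | hij
    · simp only [if_true, mul_one, ← Int.cast_mul, ← Units.val_mul, Int.units_mul_self]
      simp
    · simp [hij]
  exact ⟨mul_eq_one_comm.mp h, h⟩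

/-- Flipping the sign at `x` permutes the sign vectors and negates every summand. -/
theorem sum_signs (x : I) : ∑ ε : I → ℤˣ, ((ε x : ℤ) : ℂ) = 0 := by
  have h := Equiv.sum_comp (Equiv.mulRight (Pi.mulSingle x (-1) : I → ℤˣ))
    fun ε : I → ℤˣ => ((ε x : ℤ) : ℂ)
  simp at h
  linear_combination (-1 / 2 : ℂ) * h

theorem sum_signs_mul (x y : I) : ∑ ε : I → ℤˣ, ((ε x : ℤ) : ℂ) * ((ε y : ℤ) : ℂ) =
    if x = y then (Fintype.card (I → ℤˣ) : ℂ) else 0 := by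
  split_ifs with hxy
  · subst hxy
    simp only [← Int.cast_mul, ← Units.val_mul, Int.units_mul_self]
    simp
  · have h := Equiv.sum_comp (Equiv.mulRight (Pi.mulSingle x (-1) : I → ℤˣ))
      fun ε : I → ℤˣ => ((ε x : ℤ) : ℂ) * ((ε y : ℤ) : ℂ)
    simp [Pi.mulSingle_eq_of_ne (Ne.symm hxy)] at h
    linear_combination (-1 / 2 : ℂ) * h

/-- Composing with a transposition shows that the sum does not depend on `x`; summing over all `x`
then determines it. -/
theorem sum_perm_apply (f : I → ℂ) (x : I) : ∑ σ : Equiv.Perm I, f (σ x) =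
    Fintype.card (Equiv.Perm I) * ((Fintype.card I : ℂ)⁻¹ * ∑ z, f z) := by
  have h1 : ∀ y, ∑ σ : Equiv.Perm I, f (σ y) = ∑ σ : Equiv.Perm I, f (σ x) := fun y => by
    have h := Equiv.sum_comp (Equiv.mulRight (Equiv.swap x y)) fun σ : Equiv.Perm I => f (σ x)
    simpa using h
  have h2 : ∑ y, ∑ σ : Equiv.Perm I, f (σ y) = Fintype.card (Equiv.Perm I) * ∑ z, f z := by
    rw [Finset.sum_comm]
    simp [fun σ : Equiv.Perm I => Equiv.sum_comp σ f]
  rw [Finset.sum_congr rfl fun y _ => h1 y] at h2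
  have hne : (Fintype.card I : ℂ) ≠ 0 := by
    have : Nonempty I := ⟨x⟩
    simp
  rw [Finset.sum_const, nsmul_eq_mul, Finset.card_univ] at h2
  field_simp
  rw [mul_comm, h2]

/-- Twirling over all signed permutations. -/
theorem sum_signs_perm (f : I → I → ℂ) (x y : I) :
    ∑ g : (I → ℤˣ) × Equiv.Perm I,
        ((g.1 x : ℤ) : ℂ) * ((g.1 y : ℤ) : ℂ) * f (g.2 x) (g.2 y) =
      Fintype.card ((I → ℤˣ) × Equiv.Perm I) *
        if x = y then (Fintype.card I : ℂ)⁻¹ * ∑ z, f z z else 0 := by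
  rw [Fintype.sum_prod_type]
  simp only [← Finset.mul_sum, ← Finset.sum_mul]
  rw [sum_signs_mul]
  split_ifs with h
  · subst h
    rw [sum_perm_apply fun z => f z z, Fintype.card_prod, Nat.cast_mul, mul_assoc]
  · simp

/-- Used for matrix entries between a twirled block and a fixed one: only one random sign occurs,
and it averages to zero. -/
theorem sum_signs_perm_single (f : I → ℂ) (x : I) :
    ∑ g : (I → ℤˣ) × Equiv.Perm I, ((g.1 x : ℤ) : ℂ) * f (g.2 x) = 0 := by
  rw [Fintype.sum_prod_type]
  simp only [← Finset.mul_sum, ← Finset.sum_mul]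
  rw [sum_signs, zero_mul]

end RandomUnitary

/-! ### The maps `N_B` and `M` are random unitary. -/

section Construction

variable {A B H K : Type*} [Fintype A] [Fintype B] [Fintype H] [Fintype K]
  [DecidableEq A] [DecidableEq B] [DecidableEq H] [DecidableEq K]

theorem isRandomUnitary_mixOut :
    IsRandomUnitary (mixOut : Matrix (K × B) (K × B) ℂ → Matrix (K × B) (K × B) ℂ) := by
  refine isRandomUnitary_average (ι := (B → ℤˣ) × Equiv.Perm B)
    -- Signs and permutations act on the factor `B` alone.
    (fun g => signedPerm (fun x => g.1 x.2) ((Equiv.refl K).prodCongr g.2))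
    (fun g => isUnitaryMap_signedPerm _ _) fun X => ?_
  ext ⟨k, x⟩ ⟨l, y⟩
  have h := sum_signs_perm (fun z w => X (k, z) (l, w)) x y
  rw [Matrix.smul_apply, Matrix.sum_apply]
  simp only [signedPerm_conj_apply, Equiv.prodCongr_apply, Prod.map, Equiv.refl_apply]
  rw [h, smul_eq_mul, inv_mul_cancel_left₀ (by simp)]
  simp [mixOut, maxMixed, partialTrace, Matrix.one_apply, mul_comm]

theorem ketbra_eq_diagonal (a₀ : A) :
    ketbra a₀ = diagonal fun a => if a = a₀ then (1 : ℂ) else 0 := by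
  ext i j
  simp only [ketbra, Matrix.single_apply, diagonal_apply]
  grind

theorem projZero_eq_diagonal (a₀ : A) :
    (projZero a₀ : Matrix (A × H) (A × H) ℂ) =
      diagonal fun x => if x.1 = a₀ then (1 : ℂ) else 0 := by
  rw [projZero, ketbra_eq_diagonal, ← diagonal_one, diagonal_kronecker_diagonal]
  simp

theorem projPerp_eq_diagonal (a₀ : A) :
    (projPerp a₀ : Matrix (A × H) (A × H) ℂ) =
      diagonal fun x => if x.1 = a₀ then (0 : ℂ) else 1 := by
  rw [projPerp, ketbra_eq_diagonal, ← diagonal_one, ← diagonal_one, diagonal_sub,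
    diagonal_kronecker_diagonal]
  congr 1; ext x
  split_ifs <;> simp

theorem mix_apply (a₀ : A) (X : Matrix (A × H) (A × H) ℂ) (x y : A × H) :
    mix a₀ X x y = (if x.1 = a₀ ∧ y.1 = a₀ then X x y else 0) +
      if x = y ∧ x.1 ≠ a₀ then
        (((Fintype.card A : ℂ) - 1) * Fintype.card H)⁻¹ *
          ∑ z : A × H, if z.1 = a₀ then 0 else X z z
      else 0 := by
  have h1 : (projZero a₀ * X * projZero a₀ : Matrix (A × H) (A × H) ℂ) x y =
      if x.1 = a₀ ∧ y.1 = a₀ then X x y else 0 := by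
    rw [projZero_eq_diagonal, mul_diagonal, diagonal_mul]
    grind
  have h2 : ((projPerp a₀ : Matrix (A × H) (A × H) ℂ) * X * projPerp a₀).trace =
      ∑ z : A × H, if z.1 = a₀ then 0 else X z z := by
    rw [projPerp_eq_diagonal, Matrix.trace]
    refine Finset.sum_congr rfl fun z _ => ?_
    rw [diag_apply, mul_diagonal, diagonal_mul]
    split_ifs <;> simp
  have h3 : ((1 - ketbra a₀) ⊗ₖ (1 : Matrix H H ℂ)) x y = if x = y ∧ x.1 ≠ a₀ then 1 else 0 := by
    rw [← projPerp, projPerp_eq_diagonal, diagonal_apply]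
    grind
  rw [mix, maxMixed, smul_kronecker, kronecker_smul, Matrix.add_apply, h1, h2, Matrix.smul_apply,
    Matrix.smul_apply, Matrix.smul_apply, h3, mul_inv]
  simp only [smul_eq_mul]
  split_ifs <;> ring

theorem decohere_apply (a₀ : A) (X : Matrix (A × H) (A × H) ℂ) (x y : A × H) :
    decohere a₀ X x y = if (x.1 = a₀ ↔ y.1 = a₀) then X x y else 0 := by
  have h : (phaseFlip a₀ : Matrix (A × H) (A × H) ℂ) =
      diagonal fun x => if x.1 = a₀ then (1 : ℂ) else -1 := by
    rw [phaseFlip, projZero_eq_diagonal, projPerp_eq_diagonal, diagonal_sub]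
    congr 1; ext x
    split_ifs <;> simp
  rw [decohere, h, diagonal_conjTranspose, Matrix.add_apply, Matrix.smul_apply, Matrix.smul_apply,
    mul_diagonal, diagonal_mul]
  by_cases hx : x.1 = a₀ <;> by_cases hy : y.1 = a₀ <;> simp [hx, hy] <;> ring

/-- `M` reads only the two diagonal blocks, which `D` leaves alone. -/
theorem mix_decohere (a₀ : A) (X : Matrix (A × H) (A × H) ℂ) :
    mix a₀ (decohere a₀ X) = mix a₀ X := by
  ext x y
  simp only [mix_apply, decohere_apply, if_true]
  grind

theorem card_fst_ne (a₀ : A) :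
    (Fintype.card {x : A × H // x.1 ≠ a₀} : ℂ) = ((Fintype.card A : ℂ) - 1) * Fintype.card H := by
  have e : {x : A × H // x.1 ≠ a₀} ≃ {a : A // a ≠ a₀} × H :=
    { toFun := fun x => (⟨x.1.1, x.2⟩, x.1.2)
      invFun := fun x => ⟨(x.1.1, x.2), x.1.2⟩
      left_inv := fun _ => rfl
      right_inv := fun _ => rfl }
  have h : Fintype.card {a : A // a ≠ a₀} + 1 = Fintype.card A := by
    have := Fintype.card_subtype_compl (fun a => a = a₀)
    have h1 : 0 < Fintype.card A := Fintype.card_pos_iff.mpr ⟨a₀⟩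
    simp only [Fintype.card_subtype_eq] at this
    simp only [ne_eq]
    omega
  rw [Fintype.card_congr e, Fintype.card_prod, ← h]
  push_cast
  ring

theorem isRandomUnitary_mix (a₀ : A) :
    IsRandomUnitary (mix a₀ : Matrix (A × H) (A × H) ℂ → Matrix (A × H) (A × H) ℂ) := by
  let S := {x : A × H // x.1 ≠ a₀}
  -- The twirl runs over signed permutations of the basis vectors outside `|0⟩ ⊗ H`, extended by the
  -- identity.
  let s : (S → ℤˣ) → A × H → ℤˣ := fun ε x => if h : x.1 ≠ a₀ then ε ⟨x, h⟩ else 1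
  refine isRandomUnitary_average (ι := (S → ℤˣ) × Equiv.Perm S)
    (fun g => signedPerm (s g.1) (Equiv.Perm.ofSubtype g.2))
    (fun g => isUnitaryMap_signedPerm _ _) fun X => ?_
  have hs : ∀ (ε : S → ℤˣ) (x : S), s ε x = ε x := fun ε x => dif_pos x.2
  have hs' : ∀ (ε : S → ℤˣ) (x : A × H), x.1 = a₀ → s ε x = 1 := fun ε x hx =>
    dif_neg (not_not.mpr hx)
  have hσ : ∀ (σ : Equiv.Perm S) (x : S), Equiv.Perm.ofSubtype σ (x : A × H) = σ x :=
    fun σ x => Equiv.Perm.ofSubtype_apply_coe σ x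
  have hσ' : ∀ (σ : Equiv.Perm S) (x : A × H), x.1 = a₀ → Equiv.Perm.ofSubtype σ x = x :=
    fun σ x hx => Equiv.Perm.ofSubtype_apply_of_not_mem σ (not_not.mpr hx)
  have htr : (∑ z : A × H, if z.1 = a₀ then 0 else X z z) = ∑ z : S, X z z := by
    rw [← Finset.sum_subtype (Finset.univ.filter fun z : A × H => z.1 ≠ a₀) (by simp)
      (fun z => X z z), Finset.sum_filter]
    exact Finset.sum_congr rfl fun z _ => by split_ifs <;> simp_all
  ext x y
  rw [Matrix.smul_apply, Matrix.sum_apply, mix_apply, htr, ← card_fst_ne a₀]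
  simp only [signedPerm_conj_apply]
  by_cases hx : x.1 = a₀ <;> by_cases hy : y.1 = a₀
  · simp only [hs' _ x hx, hs' _ y hy, hσ' _ x hx, hσ' _ y hy, hx, hy, Units.val_one, Int.cast_one,
      one_mul, Finset.sum_const, Finset.card_univ, nsmul_eq_mul, smul_eq_mul]
    rw [inv_mul_cancel_left₀ (by simp)]
    simp
  · lift y to S using hy
    have h := sum_signs_perm_single (fun z : S => X x z) y
    simp only [hs, hs' _ x hx, hσ, hσ' _ x hx, Units.val_one, Int.cast_one, one_mul, h, hx, y.2]
    simp
  · lift x to S using hx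
    have h := sum_signs_perm_single (fun z : S => X z y) x
    simp only [hs, hs' _ y hy, hσ, hσ' _ y hy, Units.val_one, Int.cast_one, mul_one, h, x.2]
    simp
    rintro rfl h; exact absurd hy h
  · lift x to S using hx
    lift y to S using hy
    have h := sum_signs_perm (fun z w : S => X z w) x y
    simp only [hs, hσ, h]
    rw [smul_eq_mul, inv_mul_cancel_left₀ (by simp)]
    simp only [x.2, ne_eq, not_false_eq_true, and_true, false_and, if_false, zero_add]
    by_cases hxy : x = y
    · rw [if_pos hxy, if_pos (congrArg Subtype.val hxy)]
    · rw [if_neg hxy, if_neg (mt Subtype.ext hxy)]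

theorem isRandomUnitary_ruApprox (a₀ : A) {U : Matrix (K × B) (A × H) ℂ} (hU : IsUnitaryMap U) :
    IsRandomUnitary (ruApprox a₀ U) := by
  have h := isRandomUnitary_mixOut.comp ((isRandomUnitary_conj hU).comp (isRandomUnitary_mix a₀))
  convert h using 1
  ext1 X
  simp only [ruApprox, mix_decohere, Function.comp_apply]

end Construction

/-! ### Existence of Stinespring dilations. -/

section Dilation

variable {A B H K : Type*} [Fintype A] [Fintype B] [Fintype H] [Fintype K]
  [DecidableEq A] [DecidableEq B] [DecidableEq H] [DecidableEq K]

open scoped MatrixOrder Matrix.Norms.L2Operator in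
theorem exists_eq_conjTranspose_mul_self {n : Type*} [Fintype n] [DecidableEq n]
    {A : Matrix n n ℂ} (hA : A.PosSemidef) : ∃ L : Matrix n n ℂ, A = Lᴴ * L :=
  CStarAlgebra.nonneg_iff_eq_star_mul_self.mp hA.nonneg

/-- The Choi factorization of a completely positive map. -/
theorem IsChannel.exists_choi_factor {Φ : Matrix H H ℂ →ₗ[ℂ] Matrix K K ℂ} (hΦ : IsChannel Φ) :
    ∃ V : H × K → H → K → ℂ, ∀ h h' k k',
      Φ (single h h' 1) k k' = ∑ r, V r h k * star (V r h' k') := by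
  let e := Fintype.equivFin H
  -- The unnormalized maximally entangled vector; the ampliation of `Φ` takes its projector to the
  -- Choi matrix.
  let v : Fin (Fintype.card H) × H → ℂ := fun p => if e p.2 = p.1 then 1 else 0
  obtain ⟨L, hL⟩ := exists_eq_conjTranspose_mul_self
    (hΦ.completelyPositive _ _ (posSemidef_vecMulVec_self_star v))
  refine ⟨fun r h k => star (L (e r.1, r.2) (e h, k)), fun h h' k k' => ?_⟩
  have h1 := congrFun (congrFun hL (e h, k)) (e h', k')
  have h2 : (Matrix.of fun x y => vecMulVec v (star v) (e h, x) (e h', y)) = single h h' 1 := by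
    ext x y
    simp only [of_apply, vecMulVec_apply, v, Pi.star_apply, single_apply, e.apply_eq_iff_eq]
    grind [star_one, star_zero]
  rw [ampliation, of_apply, h2] at h1
  rw [h1, Matrix.mul_apply, ← (e.prodCongr (Equiv.refl K)).sum_comp]
  simp [Prod.map]

theorem linearMap_apply_eq_sum (Φ : Matrix H H ℂ →ₗ[ℂ] Matrix K K ℂ) (X : Matrix H H ℂ) (k k' : K) :
    Φ X k k' = ∑ h, ∑ h', X h h' * Φ (single h h' 1) k k' := by
  conv_lhs => rw [matrix_eq_sum_single X]
  simp only [map_sum, Matrix.sum_apply]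
  refine Finset.sum_congr rfl fun h _ => Finset.sum_congr rfl fun h' _ => ?_
  have : single h h' (X h h') = X h h' • single h h' (1 : ℂ) := by simp [smul_single]
  rw [this, map_smul, Matrix.smul_apply, smul_eq_mul]

theorem mul_ketbra_kronecker_mul_apply (a₀ : A) {J : Type*} (U : Matrix J (A × H) ℂ)
    (X : Matrix H H ℂ) (i j : J) :
    (U * (ketbra a₀ ⊗ₖ X) * Uᴴ) i j =
      ∑ h, ∑ h', X h h' * (U i (a₀, h) * star (U j (a₀, h'))) := by
  have h1 : ∀ x : A × H, (U * (ketbra a₀ ⊗ₖ X)) i x =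
      if a₀ = x.1 then ∑ h, U i (a₀, h) * X h x.2 else 0 := by
    intro x
    rw [Matrix.mul_apply, Fintype.sum_prod_type, Finset.sum_eq_single a₀]
    · simp only [ketbra]
      split_ifs <;> simp_all
    · intro a _ ha
      simp [ketbra, ha.symm]
    · simp
  rw [Matrix.mul_apply, Fintype.sum_prod_type, Finset.sum_eq_single a₀]
  · simp only [h1, if_true, conjTranspose_apply, Finset.sum_mul]
    rw [Finset.sum_comm]
    exact Finset.sum_congr rfl fun _ _ => Finset.sum_congr rfl fun _ _ => by ring
  · intro a _ ha
    simp [h1, ha.symm]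
  · simp

/-- Completing orthonormal columns to a unitary matrix. -/
theorem exists_isUnitaryMap_extension {I J : Type*} [Fintype I] [Fintype J] [DecidableEq I]
    [DecidableEq J] (hcard : Fintype.card J = Fintype.card I) (s : Set I) (W : J → I → ℂ)
    (hW : ∀ i ∈ s, ∀ j ∈ s, ∑ x, star (W x i) * W x j = if i = j then 1 else 0) :
    ∃ U : Matrix J I ℂ, IsUnitaryMap U ∧ ∀ i ∈ s, ∀ x, U x i = W x i := by
  let v : I → EuclideanSpace ℂ J := fun i => WithLp.toLp 2 fun x => W x i
  have hv : Orthonormal ℂ (s.domRestrict v) := by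
    rw [orthonormal_iff_ite]
    rintro ⟨i, hi⟩ ⟨j, hj⟩
    have := hW i hi j hj
    simp only [Set.domRestrict_apply, PiLp.inner_apply, v, RCLike.inner_apply, Subtype.mk.injEq]
    rw [← this]
    exact Finset.sum_congr rfl fun x _ => mul_comm _ _
  obtain ⟨u, hu⟩ := hv.exists_orthonormalBasis_extension_of_card_eq (by simpa using hcard)
  let U : Matrix J I ℂ := Matrix.of fun x i => u i x
  have h1 : Uᴴ * U = 1 := by
    ext i j
    have := orthonormal_iff_ite.mp u.orthonormal i j
    rw [Matrix.one_apply, ← this, Matrix.mul_apply, PiLp.inner_apply]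
    exact Finset.sum_congr rfl fun x _ => mul_comm _ _
  refine ⟨U, ⟨h1, (mul_eq_one_comm_of_card_eq _ _ _ hcard).mpr h1⟩, fun i hi x => ?_⟩
  simp only [U, of_apply, hu i hi, v]

theorem IsChannel.exists_stinespringDilation [Nonempty H] {Φ : Matrix H H ℂ →ₗ[ℂ] Matrix K K ℂ}
    (hΦ : IsChannel Φ) :
    ∃ (m n : ℕ) (a₀ : Fin m) (U : Matrix (K × Fin n) (Fin m × H) ℂ),
      IsStinespringDilation Φ a₀ U := by
  obtain ⟨V, hV⟩ := hΦ.exists_choi_factor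
  have hK : Nonempty K := by
    by_contra h
    rw [not_nonempty_iff] at h
    have := hΦ.tracePreserving 1
    rw [trace_one, Matrix.trace, Fintype.sum_empty] at this
    exact Fintype.card_ne_zero (α := H) (by exact_mod_cast this.symm)
  let e := Fintype.equivFin (H × K)
  have hpos : 0 < Fintype.card (K × K) := Fintype.card_pos
  -- With `dim A = (dim K)²` and `dim B = dim H · dim K`, both sides of `U` have dimension `(dim K)²
  -- · dim H`. The Kraus operators fill the columns labelled `(a₀, h)`, and trace preservation makes
  -- these orthonormal.
  let a₀ : Fin (Fintype.card (K × K)) := ⟨0, hpos⟩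
  let W : K × Fin (Fintype.card (H × K)) → Fin (Fintype.card (K × K)) × H → ℂ :=
    fun x i => V (e.symm x.2) i.2 x.1
  obtain ⟨U, hU, hUW⟩ := exists_isUnitaryMap_extension (I := Fin (Fintype.card (K × K)) × H)
    (J := K × Fin (Fintype.card (H × K))) (by simp; ring) {i | i.1 = a₀} W (by
      rintro ⟨_, h⟩ rfl ⟨_, h'⟩ rfl
      have h1 := hΦ.tracePreserving (single h' h 1)
      simp only [Matrix.trace, diag_apply, hV] at h1
      rw [Fintype.sum_prod_type]
      simp only [W]
      calc _ = ∑ k, ∑ r, V r h' k * star (V r h k) := by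
            refine Finset.sum_congr rfl fun k _ => ?_
            rw [← e.sum_comp]
            refine Finset.sum_congr rfl fun r _ => ?_
            rw [e.symm_apply_apply, mul_comm]
        _ = _ := by
          rw [h1]
          change trace (single h' h 1) = _
          rcases eq_or_ne h h' with rfl | hne
          · simp
          · rw [trace_single_eq_of_ne _ _ _ hne.symm, if_neg (by simpa using hne)])
  refine ⟨_, _, a₀, U, hU, fun X => ?_⟩
  ext k k'
  rw [linearMap_apply_eq_sum, partialTrace, of_apply]
  simp only [mul_ketbra_kronecker_mul_apply]
  refine Eq.trans ?_ Finset.sum_comm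
  refine Finset.sum_congr rfl fun h _ => ?_
  refine Eq.trans ?_ Finset.sum_comm
  refine Finset.sum_congr rfl fun h' _ => ?_
  rw [← Finset.mul_sum, hV, ← e.sum_comp]
  congr 1
  refine Finset.sum_congr rfl fun r _ => ?_
  rw [hUW _ rfl, hUW _ rfl]
  simp [W]

end Dilation

/-! ### Normalization of states and an eigenvalue bound. -/

section States

variable {n : Type*} [Fintype n] [DecidableEq n]

theorem isDensity_maxMixed [Nonempty n] : IsDensity (maxMixed n) := by
  refine ⟨PosSemidef.one.smul (by simp), ?_⟩
  rw [maxMixed, trace_smul, trace_one, smul_eq_mul, inv_mul_cancel₀ (by simp)]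

/-- A positive operator is a nonnegative multiple of a density operator. -/
theorem exists_isDensity_smul [Nonempty n] {A : Matrix n n ℂ} (hA : A.PosSemidef) :
    ∃ ρ, IsDensity ρ ∧ A = A.trace • ρ := by
  rcases eq_or_ne A.trace 0 with h | h
  · exact ⟨maxMixed n, isDensity_maxMixed, by rw [h, zero_smul]; exact hA.trace_eq_zero_iff.mp h⟩
  · refine ⟨A.trace⁻¹ • A, ⟨hA.smul (by simpa using hA.trace_nonneg), ?_⟩, ?_⟩
    · rw [trace_smul, smul_eq_mul, inv_mul_cancel₀ h]
    · rw [smul_smul, mul_inv_cancel₀ h, one_smul]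

theorem eigenvalues_le_of_posSemidef_sub {A : Matrix n n ℂ} (hA : A.IsHermitian) {c : ℝ}
    (h : ((c : ℂ) • 1 - A).PosSemidef) (i : n) : hA.eigenvalues i ≤ c := by
  obtain ⟨V, h1, -, h3⟩ := spectral_decomposition hA
  have hd : Vᴴ * ((c : ℂ) • 1 - A) * V =
      (c : ℂ) • 1 - diagonal (fun i => (hA.eigenvalues i : ℂ)) := by
    have h4 : Vᴴ * A * V = diagonal (fun i => (hA.eigenvalues i : ℂ)) := by
      calc _ = Vᴴ * V * diagonal (fun i => (hA.eigenvalues i : ℂ)) * (Vᴴ * V) := by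
            conv_lhs => rw [h3]
            simp only [Matrix.mul_assoc]
        _ = _ := by simp [h1]
    rw [Matrix.mul_sub, Matrix.sub_mul, h4, Matrix.mul_smul, Matrix.smul_mul, Matrix.mul_one, h1]
  have h5 := (h.conjTranspose_mul_mul_same V).diag_nonneg (i := i)
  rw [hd] at h5
  have h6 := (Complex.nonneg_iff.mp h5).1
  simpa using h6

end States

/-! ### The output of `Φ'` and the entropy estimates. -/

section Construction

variable {A B H K : Type*} [Fintype A] [Fintype B] [Fintype H] [Fintype K]
  [DecidableEq A] [DecidableEq B] [DecidableEq H] [DecidableEq K]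

theorem trace_partialTrace (X : Matrix (K × B) (K × B) ℂ) : (partialTrace X).trace = X.trace := by
  simp [Matrix.trace, partialTrace, Fintype.sum_prod_type]

theorem posSemidef_partialTrace {X : Matrix (K × B) (K × B) ℂ} (hX : X.PosSemidef) :
    (partialTrace X).PosSemidef := by
  have h : partialTrace X = ∑ b : B, X.submatrix (fun k => (k, b)) (fun k => (k, b)) := by
    ext i j
    simp [partialTrace, Matrix.sum_apply]
  rw [h]
  exact posSemidef_sum _ fun b _ => hX.submatrix _

theorem partialTrace_add (X Y : Matrix (K × B) (K × B) ℂ) :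
    partialTrace (X + Y) = partialTrace X + partialTrace Y := by
  ext i j
  simp [partialTrace, Finset.sum_add_distrib]

theorem partialTrace_smul (c : ℂ) (X : Matrix (K × B) (K × B) ℂ) :
    partialTrace (c • X) = c • partialTrace X := by
  ext i j
  simp [partialTrace, Finset.mul_sum]

theorem partialTrace_one :
    partialTrace (1 : Matrix (K × B) (K × B) ℂ) = (Fintype.card B : ℂ) • 1 := by
  ext i j
  simp [partialTrace, Matrix.one_apply]

/-- The block of an operator on the subspace `|0⟩ ⊗ H`. -/
def zeroBlock (a₀ : A) (X : Matrix (A × H) (A × H) ℂ) : Matrix H H ℂ :=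
  X.submatrix (fun h => (a₀, h)) (fun h => (a₀, h))

theorem projZero_mul_mul_projZero (a₀ : A) (X : Matrix (A × H) (A × H) ℂ) :
    projZero a₀ * X * projZero a₀ = ketbra a₀ ⊗ₖ zeroBlock a₀ X := by
  ext ⟨a, h⟩ ⟨a', h'⟩
  rw [projZero_eq_diagonal, mul_diagonal, diagonal_mul]
  simp only [kronecker_apply, ketbra, single_apply, zeroBlock, submatrix_apply]
  by_cases ha : a = a₀ <;> by_cases ha' : a' = a₀ <;> simp [ha, ha', eq_comm (a := a₀)]

theorem zeroBlock_ketbra_kronecker (a₀ : A) (ρ : Matrix H H ℂ) :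
    zeroBlock a₀ (ketbra a₀ ⊗ₖ ρ) = ρ := by
  ext h h'
  simp [zeroBlock, ketbra]

theorem trace_ketbra_kronecker (a₀ : A) (ρ : Matrix H H ℂ) :
    (ketbra a₀ ⊗ₖ ρ).trace = ρ.trace := by
  rw [trace_kronecker, ketbra, trace_single_eq_same, one_mul]

theorem posSemidef_ketbra (a₀ : A) : (ketbra a₀).PosSemidef := by
  rw [ketbra_eq_diagonal]
  exact PosSemidef.diagonal fun a => by dsimp only; split_ifs <;> simp

theorem posSemidef_one_sub_ketbra (a₀ : A) : (1 - ketbra a₀).PosSemidef := by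
  rw [ketbra_eq_diagonal, ← diagonal_one, diagonal_sub]
  exact PosSemidef.diagonal fun a => by dsimp only; split_ifs <;> simp

theorem isHermitian_projPerp (a₀ : A) : (projPerp a₀ : Matrix (A × H) (A × H) ℂ).IsHermitian :=
  ((posSemidef_one_sub_ketbra a₀).kronecker PosSemidef.one).isHermitian

theorem trace_projPerp (a₀ : A) (X : Matrix (A × H) (A × H) ℂ) :
    (projPerp a₀ * X * projPerp a₀).trace = X.trace - (zeroBlock a₀ X).trace := by
  have h1 : (projZero a₀ * X * projZero a₀).trace = (zeroBlock a₀ X).trace := by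
    rw [projZero_mul_mul_projZero, trace_ketbra_kronecker]
  rw [← h1, projPerp_eq_diagonal, projZero_eq_diagonal]
  simp only [Matrix.trace, diag_apply, mul_diagonal, diagonal_mul, ← Finset.sum_sub_distrib]
  refine Finset.sum_congr rfl fun x _ => ?_
  split_ifs <;> simp

/-- The output of `tr_B U · U*` on the maximally mixed state of the complement of `|0⟩ ⊗ H`. -/
noncomputable def perpOutput (a₀ : A) (U : Matrix (K × B) (A × H) ℂ) : Matrix K K ℂ :=
  partialTrace (U * ((((Fintype.card A : ℂ) - 1)⁻¹ • (1 - ketbra a₀)) ⊗ₖ maxMixed H) * Uᴴ)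

variable {Φ : Matrix H H ℂ →ₗ[ℂ] Matrix K K ℂ} {a₀ : A} {U : Matrix (K × B) (A × H) ℂ}

namespace IsStinespringDilation

theorem ruApprox_eq (hU : IsStinespringDilation Φ a₀ U) (X : Matrix (A × H) (A × H) ℂ) :
    ruApprox a₀ U X = (Φ (zeroBlock a₀ X) +
      (X.trace - (zeroBlock a₀ X).trace) • perpOutput a₀ U) ⊗ₖ maxMixed B := by
  rw [ruApprox, mix_decohere, mixOut, mix, projZero_mul_mul_projZero, trace_projPerp,
    Matrix.mul_add, Matrix.add_mul, partialTrace_add, ← hU.2, Matrix.mul_smul, Matrix.smul_mul,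
    partialTrace_smul, perpOutput]

/-- The traces of `Uᴴ * U` and `U * Uᴴ` agree. -/
theorem card_mul_card (hU : IsStinespringDilation Φ a₀ U) :
    Fintype.card K * Fintype.card B = Fintype.card A * Fintype.card H := by
  have h1 := congrArg Matrix.trace hU.1.1
  have h2 := congrArg Matrix.trace hU.1.2
  rw [Matrix.trace_mul_comm, h2, trace_one, trace_one] at h1
  simpa using (by exact_mod_cast h1 : Fintype.card (K × B) = Fintype.card (A × H))

theorem isDensity_apply (hU : IsStinespringDilation Φ a₀ U) {ρ : Matrix H H ℂ}
    (hρ : IsDensity ρ) : IsDensity (Φ ρ) := by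
  rw [hU.2]
  refine ⟨posSemidef_partialTrace
    (((posSemidef_ketbra a₀).kronecker hρ.1).mul_mul_conjTranspose_same U), ?_⟩
  rw [trace_partialTrace, Matrix.trace_mul_comm, ← Matrix.mul_assoc, hU.1.1, Matrix.one_mul,
    trace_ketbra_kronecker, hρ.2]

/-- The mixed state on the complement is a combination of the identity, which `U` preserves, and
`|0⟩⟨0| ⊗ I_H / dim H`, which yields `Φ (maxMixed H)`. -/
theorem perpOutput_eq (hU : IsStinespringDilation Φ a₀ U) :
    perpOutput a₀ U = ((Fintype.card A : ℂ) - 1)⁻¹ •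
      (((Fintype.card B : ℂ) / Fintype.card H) • 1 - Φ (maxMixed H)) := by
  have h : (((Fintype.card A : ℂ) - 1)⁻¹ • (1 - ketbra a₀)) ⊗ₖ maxMixed H =
      (((Fintype.card A : ℂ) - 1)⁻¹ * (Fintype.card H : ℂ)⁻¹) • (1 : Matrix (A × H) (A × H) ℂ) +
        (-((Fintype.card A : ℂ) - 1)⁻¹) • (ketbra a₀ ⊗ₖ maxMixed H) := by
    have h1 : (1 - ketbra a₀ : Matrix A A ℂ) = 1 + (-1 : ℂ) • ketbra a₀ := by
      rw [neg_one_smul, sub_eq_add_neg]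
    rw [smul_kronecker, h1, add_kronecker, smul_kronecker, smul_add, smul_smul, mul_neg_one,
      maxMixed, kronecker_smul _ (1 : Matrix A A ℂ), one_kronecker_one, smul_smul]
  rw [perpOutput, h, Matrix.mul_add, Matrix.add_mul, partialTrace_add, Matrix.mul_smul,
    Matrix.smul_mul, Matrix.mul_smul, Matrix.smul_mul, partialTrace_smul, partialTrace_smul,
    ← hU.2, Matrix.mul_one, hU.1.2, partialTrace_one, smul_smul, smul_sub, smul_smul, neg_smul,
    ← sub_eq_add_neg, div_eq_inv_mul, mul_assoc]

variable [Nonempty H]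

theorem isDensity_perpOutput (hU : IsStinespringDilation Φ a₀ U) (hA : 2 ≤ Fintype.card A) :
    IsDensity (perpOutput a₀ U) := by
  have hA' : (1 : ℝ) ≤ (Fintype.card A : ℝ) - 1 := by
    have : (2 : ℝ) ≤ Fintype.card A := by exact_mod_cast hA
    linarith
  have hne : (Fintype.card A : ℂ) - 1 ≠ 0 := by
    intro h
    have h' : (Fintype.card A : ℝ) - 1 = 0 := by exact_mod_cast h
    linarith
  have hpos : (0 : ℂ) ≤ ((Fintype.card A : ℂ) - 1)⁻¹ := by
    have h : (0 : ℝ) ≤ ((Fintype.card A : ℝ) - 1)⁻¹ := inv_nonneg.mpr (by linarith)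
    have h' := Complex.zero_le_real.mpr h
    push_cast at h'
    exact h'
  constructor
  · exact posSemidef_partialTrace ((((posSemidef_one_sub_ketbra a₀).smul hpos).kronecker
      isDensity_maxMixed.1).mul_mul_conjTranspose_same U)
  · have hH : (Fintype.card H : ℂ) ≠ 0 := by simp
    have hc : (Fintype.card K : ℂ) * Fintype.card B = Fintype.card A * Fintype.card H := by
      exact_mod_cast hU.card_mul_card
    rw [hU.perpOutput_eq, trace_smul, trace_sub, trace_smul, trace_one,
      (hU.isDensity_apply isDensity_maxMixed).2, smul_eq_mul, smul_eq_mul]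
    field_simp
    linear_combination hc

theorem neg_logb_le_entropy_perpOutput {b : ℝ} (hb : 1 < b) (hU : IsStinespringDilation Φ a₀ U)
    (hA : 2 ≤ Fintype.card A) :
    Real.logb b (Fintype.card K) -
        Real.logb b ((Fintype.card A : ℝ) / ((Fintype.card A : ℝ) - 1)) ≤
      entropy b (perpOutput a₀ U) := by
  have hA' : (0 : ℝ) < (Fintype.card A : ℝ) - 1 := by
    have : (2 : ℝ) ≤ Fintype.card A := by exact_mod_cast hA
    linarith
  have hA0 : (0 : ℝ) < Fintype.card A := by linarith
  have hω := hU.isDensity_perpOutput hA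
  have hKn := hω.nonempty
  have hK : (0 : ℝ) < Fintype.card K := by exact_mod_cast Fintype.card_pos
  have hH : (0 : ℝ) < Fintype.card H := by exact_mod_cast Fintype.card_pos
  have hc : (Fintype.card K : ℝ) * Fintype.card B = Fintype.card A * Fintype.card H := by
    exact_mod_cast hU.card_mul_card
  refine le_trans (le_of_eq ?_) (hω.neg_logb_le_entropy hb
    (c := (Fintype.card A : ℝ) / ((Fintype.card A : ℝ) - 1) / Fintype.card K)
    (eigenvalues_le_of_posSemidef_sub _ ?_))
  · rw [Real.logb_div (by positivity) hK.ne']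
    ring
  · have h1 : (Fintype.card A : ℝ) / ((Fintype.card A : ℝ) - 1) / Fintype.card K =
        ((Fintype.card A : ℝ) - 1)⁻¹ * ((Fintype.card B : ℝ) / Fintype.card H) := by
      field_simp
      linear_combination -hc
    -- The gap between `c • 1` and `ω` is a nonnegative multiple of a channel output, hence
    -- positive.
    have h2 : (((Fintype.card A : ℝ) / ((Fintype.card A : ℝ) - 1) / Fintype.card K : ℝ) : ℂ) • 1 -
        perpOutput a₀ U = ((((Fintype.card A : ℝ) - 1)⁻¹ : ℝ) : ℂ) • Φ (maxMixed H) := by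
      rw [h1, hU.perpOutput_eq]
      push_cast
      rw [smul_sub, smul_smul]
      abel
    rw [h2]
    exact (hU.isDensity_apply isDensity_maxMixed).1.smul (by exact_mod_cast (inv_pos.mpr hA').le)

end IsStinespringDilation

theorem minOutputEntropy_le {n m : Type*} [Fintype n] [Fintype m] [DecidableEq m] {b : ℝ}
    (hb : 1 < b) {Ψ : Matrix n n ℂ → Matrix m m ℂ}
    (hΨ : ∀ ρ, IsDensity ρ → IsDensity (Ψ ρ)) {ρ : Matrix n n ℂ} (hρ : IsDensity ρ) :
    minOutputEntropy b Ψ ≤ entropy b (Ψ ρ) := by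
  refine csInf_le ⟨0, ?_⟩ ⟨ρ, hρ, rfl⟩
  rintro _ ⟨σ, hσ, rfl⟩
  exact (hΨ σ hσ).entropy_nonneg hb

theorem le_minOutputEntropy {n m : Type*} [Fintype n] [Nonempty n] [DecidableEq n] [Fintype m]
    [DecidableEq m] {b c : ℝ} {Ψ : Matrix n n ℂ → Matrix m m ℂ}
    (h : ∀ ρ, IsDensity ρ → c ≤ entropy b (Ψ ρ)) : c ≤ minOutputEntropy b Ψ := by
  refine le_csInf ⟨_, maxMixed n, isDensity_maxMixed, rfl⟩ ?_
  rintro _ ⟨σ, hσ, rfl⟩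
  exact h σ hσ

theorem IsRandomUnitary.isDensity_apply {n m : Type*} [Fintype n] [DecidableEq n] [Fintype m]
    [DecidableEq m] {Ψ : Matrix n n ℂ → Matrix m m ℂ} (hΨ : IsRandomUnitary Ψ) {ρ : Matrix n n ℂ}
    (hρ : IsDensity ρ) : IsDensity (Ψ ρ) := by
  obtain ⟨k, p, V, hp, hp1, hV, h⟩ := hΨ
  rw [h]
  constructor
  · exact posSemidef_sum _ fun i _ =>
      (hρ.1.mul_mul_conjTranspose_same (V i)).smul (by exact_mod_cast hp i)
  · rw [trace_sum]
    have : ∀ i, ((p i : ℂ) • (V i * ρ * (V i)ᴴ)).trace = p i := fun i => by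
      rw [trace_smul, Matrix.trace_mul_comm, ← Matrix.mul_assoc, (hV i).1, Matrix.one_mul, hρ.2,
        smul_eq_mul, mul_one]
    simp only [this]
    exact_mod_cast hp1

/-- For natural logarithms, `log (d / (d - 1)) ≤ 1 / (d - 1) ≤ 2 / d`, and `2 ≤ 8 log d` because
`log 2 > 1/4`. -/
theorem logb_div_sub_one_le {b d : ℝ} (hb : 1 < b) (hd : 2 ≤ d) :
    Real.logb b (d / (d - 1)) ≤ 8 * Real.logb b d / d := by
  have h1 : Real.log (d / (d - 1)) ≤ 8 * Real.log d / d := by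
    have h2 : Real.log (d / (d - 1)) ≤ d / (d - 1) - 1 :=
      Real.log_le_sub_one_of_pos (div_pos (by linarith) (by linarith))
    have h3 : d / (d - 1) - 1 ≤ 2 / d := by
      rw [div_sub_one (by linarith), div_le_div_iff₀ (by linarith) (by linarith)]
      linarith
    have h4 : Real.log 2 ≤ Real.log d := Real.log_le_log (by norm_num) hd
    have h5 : 2 / d ≤ 8 * Real.log d / d :=
      div_le_div_of_nonneg_right (by linarith [Real.log_two_gt_d9]) (by linarith)
    linarith
  rw [Real.logb, Real.logb, ← mul_div_assoc, div_right_comm]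
  exact div_le_div_of_nonneg_right h1 (Real.log_pos hb).le

variable [Nonempty H]

namespace IsStinespringDilation

theorem nonempty_environment (hU : IsStinespringDilation Φ a₀ U) : Nonempty B := by
  rw [← Fintype.card_pos_iff]
  have h1 : 0 < Fintype.card A := Fintype.card_pos_iff.mpr ⟨a₀⟩
  have h2 : 0 < Fintype.card H := Fintype.card_pos
  have h3 := hU.card_mul_card
  have h4 : 0 < Fintype.card A * Fintype.card H := Nat.mul_pos h1 h2
  rw [← h3] at h4
  exact Nat.pos_of_mul_pos_left h4

theorem minOutputEntropy_ruApprox_le {b : ℝ} (hb : 1 < b) (hU : IsStinespringDilation Φ a₀ U) :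
    minOutputEntropy b (ruApprox a₀ U) - Real.logb b (Fintype.card B) ≤ minOutputEntropy b Φ := by
  have := hU.nonempty_environment
  refine le_minOutputEntropy fun ρ hρ => ?_
  have hX : IsDensity (ketbra a₀ ⊗ₖ ρ) :=
    ⟨(posSemidef_ketbra a₀).kronecker hρ.1, by rw [trace_ketbra_kronecker, hρ.2]⟩
  have h := minOutputEntropy_le hb
    (fun _ h => (isRandomUnitary_ruApprox a₀ hU.1).isDensity_apply h) hX
  rw [hU.ruApprox_eq, zeroBlock_ketbra_kronecker, trace_ketbra_kronecker, sub_self, zero_smul,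
    add_zero, entropy_kronecker_maxMixed b (hU.isDensity_apply hρ)] at h
  linarith

theorem le_minOutputEntropy_ruApprox {b : ℝ} (hb : 1 < b) (hU : IsStinespringDilation Φ a₀ U) :
    minOutputEntropy b Φ - 8 * Real.logb b (Fintype.card A) / (Fintype.card A : ℝ) ≤
      minOutputEntropy b (ruApprox a₀ U) - Real.logb b (Fintype.card B) := by
  have := hU.nonempty_environment
  have hAn : Nonempty A := ⟨a₀⟩
  rw [le_sub_iff_add_le]
  refine le_minOutputEntropy fun X hX => ?_
  have hmin : ∀ ρ, IsDensity ρ → minOutputEntropy b Φ ≤ entropy b (Φ ρ) := fun ρ hρ =>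
    minOutputEntropy_le hb (fun _ h => hU.isDensity_apply h) hρ
  have hX0 : (zeroBlock a₀ X).PosSemidef := hX.1.submatrix _
  obtain ⟨ρ, hρ, hXρ⟩ := exists_isDensity_smul hX0
  have hp := Complex.nonneg_iff.mp hX0.trace_nonneg
  obtain ⟨p, hpt⟩ : ∃ p : ℝ, (zeroBlock a₀ X).trace = p :=
    ⟨(zeroBlock a₀ X).trace.re, Complex.ext rfl hp.2.symm⟩
  have hp0 : 0 ≤ p := by simpa [hpt] using hp.1
  have hq0 : 0 ≤ 1 - p := by
    have h := (hX.1.conjTranspose_mul_mul_same (projPerp a₀)).trace_nonneg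
    rw [isHermitian_projPerp, trace_projPerp, hX.2, hpt] at h
    exact_mod_cast h
  have hout : ruApprox a₀ U X =
      ((p : ℂ) • Φ ρ + ((1 - p : ℝ) : ℂ) • perpOutput a₀ U) ⊗ₖ maxMixed B := by
    rw [hU.ruApprox_eq, hX.2, hpt]
    conv_lhs => rw [hXρ, hpt, map_smul]
    push_cast
    rfl
  have hΦρ := hU.isDensity_apply hρ
  rcases (Nat.succ_le_of_lt (Fintype.card_pos (α := A))).eq_or_lt with h1 | h2
  -- If `dim A = 1` the complement is zero, so `p = 1`, and the error term vanishes with `log 1`.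
  · have hA1 : ∀ a : A, a = a₀ := fun a =>
      Fintype.card_le_one_iff.mp (le_of_eq h1.symm) a a₀
    have hPz : (projPerp a₀ : Matrix (A × H) (A × H) ℂ) = 0 := by
      rw [projPerp_eq_diagonal, ← diagonal_zero]
      congr 1
      ext x
      simp [hA1 x.1]
    have hp1 : (1 - p : ℝ) = 0 := by
      have h := trace_projPerp a₀ X
      rw [hPz, Matrix.mul_zero, trace_zero, hX.2, hpt] at h
      exact_mod_cast h.symm
    have hp1' : p = 1 := by linarith
    rw [hout, hp1, hp1', Complex.ofReal_one, Complex.ofReal_zero, one_smul, zero_smul, add_zero,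
      entropy_kronecker_maxMixed b hΦρ, ← h1]
    simpa using hmin ρ hρ
  · have hA : 2 ≤ Fintype.card A := h2
    have hω := hU.isDensity_perpOutput hA
    have hmix : IsDensity ((p : ℂ) • Φ ρ + ((1 - p : ℝ) : ℂ) • perpOutput a₀ U) := by
      refine ⟨(hΦρ.1.smul (by exact_mod_cast hp0)).add (hω.1.smul (by exact_mod_cast hq0)), ?_⟩
      rw [trace_add, trace_smul, trace_smul, hΦρ.2, hω.2]
      simp
    rw [hout, entropy_kronecker_maxMixed b hmix]
    have h3 := entropy_concave hb hΦρ.1 hω.1 hp0 hq0 (by ring)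
    have h4 := hU.neg_logb_le_entropy_perpOutput hb hA
    have h5 := logb_div_sub_one_le hb (d := Fintype.card A) (by exact_mod_cast hA)
    have h6 := (hmin ρ hρ).trans (hΦρ.entropy_le_logb_card hb)
    have h7 : 0 ≤ 8 * Real.logb b (Fintype.card A) / (Fintype.card A : ℝ) :=
      div_nonneg (mul_nonneg (by norm_num)
        (Real.logb_nonneg hb (by exact_mod_cast Fintype.card_pos))) (by positivity)
    have h8 := mul_le_mul_of_nonneg_left (hmin ρ hρ) hp0
    -- `S(ω)` falls below `log dim K`, hence below `S_min(Φ)`, by no more than the error term.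
    have h9 : (1 - p) * (minOutputEntropy b Φ -
        8 * Real.logb b (Fintype.card A) / (Fintype.card A : ℝ)) ≤
          (1 - p) * entropy b (perpOutput a₀ U) :=
      mul_le_mul_of_nonneg_left (by linarith) hq0
    have h10 := mul_nonneg hp0 h7
    linarith

end IsStinespringDilation

end Construction

end QChan

theorem mainTheorem3 {H K : Type*} [Fintype H] [Fintype K] [DecidableEq H] [DecidableEq K]
    [Nonempty H] (b : ℝ) (hb : 1 < b)
    (Φ : Matrix H H ℂ →ₗ[ℂ] Matrix K K ℂ) (hΦ : QChan.IsChannel Φ) :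
    (∃ (m n : ℕ) (a₀ : Fin m) (U : Matrix (K × Fin n) (Fin m × H) ℂ),
      QChan.IsStinespringDilation Φ a₀ U) ∧
    ∀ (A B : Type*) [Fintype A] [Fintype B] [DecidableEq A] [DecidableEq B]
      (a₀ : A) (U : Matrix (K × B) (A × H) ℂ), QChan.IsStinespringDilation Φ a₀ U →
      QChan.IsRandomUnitary (QChan.ruApprox a₀ U) ∧
      QChan.minOutputEntropy b Φ ≥
        QChan.minOutputEntropy b (QChan.ruApprox a₀ U) - Real.logb b (Fintype.card B) ∧
      QChan.minOutputEntropy b (QChan.ruApprox a₀ U) - Real.logb b (Fintype.card B) ≥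
        QChan.minOutputEntropy b Φ -
          8 * Real.logb b (Fintype.card A) / (Fintype.card A : ℝ) := by

  refine ⟨hΦ.exists_stinespringDilation, fun A B _ _ _ _ a₀ U hU => ⟨?_, ?_, ?_⟩⟩
  · exact QChan.isRandomUnitary_ruApprox a₀ hU.1
  · exact hU.minOutputEntropy_ruApprox_le hb
  · exact hU.le_minOutputEntropy_ruApprox hb
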